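/- Let $n\ge 1$ and $d\ge 0$ be integers, let $T_1,\dots,T_n\in M_d(\mathbb C)$ be positive semidefinite matrices, and let $\vartheta_1,\dots,\vartheta_n$ be real numbers with $0\le\vartheta_k\le 1$ for every $k$ and $\sum_{k=1}^n\vartheta_k=1$. Put $r=\min\{\vartheta_k : k=1,\dots,n\}$. Then $$\sum_{k=1}^{n}\operatorname{tr}(\vartheta_k T_k)\;\ge\;\operatorname{tr}\left|\,\prod_{k=1}^{n}T_k^{\vartheta_k}\right|+r\left(\sum_{k=1}^{n}\operatorname{tr}(T_k)-n\sqrt[n]{\prod_{k=1}^{n}\operatorname{tr}(T_k)}\right).$$ Here $T^{\vartheta}$ is the power of a positive semidefinite matrix given by the functional calculus (with $T^0=I$), the product is taken in the order $T_1^{\vartheta_1}T_2^{\vartheta_2}\cdots T_n^{\vartheta_n}$, and $|A|=(A^*A)^{1/2}$. -/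

import Mathlib

open scoped MatrixOrder ComplexOrder

/-!
The trace norm of `∏ T k ^ ϑ k` is at most `∏ (tr T k) ^ ϑ k` (Hölder), which reduces the claim to a
scalar refinement of the weighted AM-GM inequality: move the weight `r` from every `a k` onto their
geometric mean `G`, which leaves the weights `ϑ k - r` and gives `G` the weight `n * r`.

For Hölder, write the trace norm as `tr (W * ∏ T k ^ ϑ k)` with `W` a contraction and replace each
`T k ^ ϑ k` by `T k ^ z k` with complex exponents. If `re z` is the vertex `e_j` of the simplex, all
factors but the `j`-th are contractions, so the trace is at most `tr T j`. Hadamard's three lines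
theorem makes the bound `∏ (tr T k) ^ re (z k)` inherited by segments, hence by the whole simplex.
-/

theorem geom_mean_weighted_add_gap_le_arith_mean_weighted {ι : Type*} (s : Finset ι)
    (w a : ι → ℝ) {r : ℝ} (hr : 0 ≤ r) (hrw : ∀ k ∈ s, r ≤ w k) (hw : ∑ k ∈ s, w k = 1)
    (ha : ∀ k ∈ s, 0 ≤ a k) :
    ∏ k ∈ s, a k ^ w k + r * (∑ k ∈ s, a k - s.card * (∏ k ∈ s, a k) ^ (1 / (s.card : ℝ)))
      ≤ ∑ k ∈ s, w k * a k := by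
  have hcard : (s.card : ℝ) ≠ 0 := by
    rw [Nat.cast_ne_zero, Finset.card_ne_zero]
    exact Finset.nonempty_of_sum_ne_zero (hw.trans_ne one_ne_zero)
  have hprod : 0 ≤ ∏ k ∈ s, a k := Finset.prod_nonneg ha
  set G := (∏ k ∈ s, a k) ^ (1 / (s.card : ℝ)) with hG
  have amgm : G ^ (s.card * r) * ∏ k ∈ s, a k ^ (w k - r)
      ≤ s.card * r * G + ∑ k ∈ s, (w k - r) * a k := by
    have := Real.geom_mean_le_arith_mean_weighted (Finset.insertNone s)
      (fun o => o.elim (s.card * r) fun k => w k - r) (fun o => o.elim G a)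
      (Finset.forall_mem_insertNone.2 ⟨mul_nonneg s.card.cast_nonneg hr,
        fun k hk => sub_nonneg.2 (hrw k hk)⟩)
      (by simp [Finset.sum_insertNone, hw])
      (Finset.forall_mem_insertNone.2 ⟨Real.rpow_nonneg hprod _, ha⟩)
    simpa only [Finset.prod_insertNone, Finset.sum_insertNone, Option.elim] using this
  have hgeom : G ^ (s.card * r) * ∏ k ∈ s, a k ^ (w k - r) = ∏ k ∈ s, a k ^ w k := by
    rw [hG, ← Real.rpow_mul hprod, one_div, inv_mul_cancel_left₀ hcard,
      ← Real.finsetProd_rpow _ _ ha, ← Finset.prod_mul_distrib]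
    refine Finset.prod_congr rfl fun k hk => ?_
    rw [← Real.rpow_add_of_nonneg (ha k hk) hr (sub_nonneg.2 (hrw k hk)), add_sub_cancel]
  rw [hgeom] at amgm
  simp only [sub_mul, Finset.sum_sub_distrib, ← Finset.mul_sum] at amgm
  linarith

section ThreeLines

variable {ι E : Type*} [NormedAddCommGroup E] [NormedSpace ℂ E]

/-- The tube domain over a set `S` of real vectors: the complex vectors with real part in `S`. -/
def tube (S : Set (ι → ℝ)) : Set (ι → ℂ) := {z | Complex.re ∘ z ∈ S}

theorem tube_mono {S S' : Set (ι → ℝ)} (h : S ⊆ S') : tube S ⊆ tube S' := fun _ hz => h hz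

theorem norm_le_rpow_mul_rpow_of_mem_tube_segment [Finite ι] {F : (ι → ℂ) → E}
    (hF : Differentiable ℂ F) {a b : ι → ℝ}
    (hbdd : BddAbove ((norm ∘ F) '' tube (segment ℝ a b))) {A B : ℝ}
    (hA : ∀ z ∈ tube {a}, ‖F z‖ ≤ A) (hB : ∀ z ∈ tube {b}, ‖F z‖ ≤ B) {s t : ℝ} (hs : 0 ≤ s)
    (ht : 0 ≤ t) (hst : s + t = 1) {z : ι → ℂ} (hz : z ∈ tube {s • a + t • b}) :
    ‖F z‖ ≤ A ^ s * B ^ t := by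
  have := Fintype.ofFinite ι
  obtain rfl : s = 1 - t := by linarith
  let line : ℂ → ι → ℂ := fun w k => z k + (w - t) * (b k - a k)
  have re_line (w : ℂ) : Complex.re ∘ line w = (1 - w.re) • a + w.re • b := by
    ext k
    have hzk : (z k).re = (1 - t) * a k + t * b k := congrFun hz k
    simp only [line, Function.comp_apply, Complex.add_re, hzk, Complex.mul_re, Complex.sub_re,
      Complex.ofReal_re, Complex.sub_im, Complex.ofReal_im, sub_zero, sub_self, mul_zero,
      Pi.add_apply, Pi.smul_apply, smul_eq_mul]
    ring
  have line_t : line t = z := by simp [line]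
  have hline : Differentiable ℂ line := by fun_prop
  have := Complex.HadamardThreeLines.norm_le_interp_of_mem_verticalClosedStrip'
    (f := F ∘ line) (z := t) (a := A) (b := B) zero_lt_one
    ⟨by simpa using ht, by simpa using hs⟩ (hF.comp hline).diffContOnCl
    (hbdd.mono <| by
      rintro _ ⟨w, ⟨hw₀, hw₁⟩, rfl⟩
      exact ⟨line w, ⟨1 - w.re, w.re, sub_nonneg.2 hw₁, hw₀, by ring, (re_line w).symm⟩, rfl⟩)
    (fun w hw => hA _ (by simp_all [tube]))
    (fun w hw => hB _ (by simp_all [tube]))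
  simpa [line_t] using this

theorem prod_rpow_mul_prod_rpow [Fintype ι] {c a b : ι → ℝ} (hc : ∀ k, 0 ≤ c k) (ha : ∀ k, 0 ≤ a k)
    (hb : ∀ k, 0 ≤ b k) {s t : ℝ} (hs : 0 ≤ s) (ht : 0 ≤ t) :
    (∏ k, c k ^ a k) ^ s * (∏ k, c k ^ b k) ^ t = ∏ k, c k ^ (s • a + t • b) k := by
  rw [← Real.finsetProd_rpow _ _ fun k _ => Real.rpow_nonneg (hc k) _,
    ← Real.finsetProd_rpow _ _ fun k _ => Real.rpow_nonneg (hc k) _, ← Finset.prod_mul_distrib]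
  refine Finset.prod_congr rfl fun k _ => ?_
  rw [← Real.rpow_mul (hc k), ← Real.rpow_mul (hc k), ← Real.rpow_add_of_nonneg (hc k)
    (mul_nonneg (ha k) hs) (mul_nonneg (hb k) ht)]
  simp only [Pi.add_apply, Pi.smul_apply, smul_eq_mul, mul_comm]

theorem norm_le_prod_rpow_of_mem_tube_stdSimplex [Fintype ι] [DecidableEq ι] {F : (ι → ℂ) → E}
    (hF : Differentiable ℂ F) (hbdd : BddAbove ((norm ∘ F) '' tube (stdSimplex ℝ ι)))
    {c : ι → ℝ} (hc : ∀ k, 0 ≤ c k) (hvertex : ∀ j, ∀ z ∈ tube {Pi.single j 1}, ‖F z‖ ≤ c j)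
    {z : ι → ℂ} (hz : z ∈ tube (stdSimplex ℝ ι)) :
    ‖F z‖ ≤ ∏ k, c k ^ (z k).re := by
  let S : Set (ι → ℝ) := {x ∈ stdSimplex ℝ ι | ∀ z ∈ tube {x}, ‖F z‖ ≤ ∏ k, c k ^ x k}
  suffices stdSimplex ℝ ι ⊆ S from (this hz).2 z rfl
  have vertices_subset : Set.range (fun j : ι => Pi.single j (1 : ℝ)) ⊆ S := by
    rintro _ ⟨j, rfl⟩
    refine ⟨single_mem_stdSimplex ℝ j, fun z hz => (hvertex j z hz).trans_eq ?_⟩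
    rw [Finset.prod_eq_single_of_mem j (Finset.mem_univ j) fun k _ hk => by simp [hk]]
    simp
  have convex_S : Convex ℝ S := by
    rintro a ⟨ha, hFa⟩ b ⟨hb, hFb⟩ s t hs ht hst
    refine ⟨convex_stdSimplex ℝ ι ha hb hs ht hst, fun z hz => ?_⟩
    rw [← prod_rpow_mul_prod_rpow hc ha.1 hb.1 hs ht]
    have hsegment := tube_mono ((convex_stdSimplex ℝ ι).segment_subset ha hb)
    exact norm_le_rpow_mul_rpow_of_mem_tube_segment hF (hbdd.mono (Set.image_mono hsegment))
      hFa hFb hs ht hst hz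
  rw [← convexHull_rangle_single_eq_stdSimplex]
  exact convexHull_min vertices_subset convex_S

end ThreeLines

theorem differentiable_prod_ofFn {𝕜 V R : Type*} [NontriviallyNormedField 𝕜]
    [NormedAddCommGroup V] [NormedSpace 𝕜 V] [NormedRing R] [NormedAlgebra 𝕜 R] {n : ℕ}
    {M : Fin n → V → R} (hM : ∀ k, Differentiable 𝕜 (M k)) :
    Differentiable 𝕜 fun z => (List.ofFn fun k => M k z).prod := by
  induction n with
  | zero => simp
  | succ n ih =>
    simp only [List.ofFn_succ, List.prod_cons]
    exact (hM 0).mul (ih fun k => hM k.succ)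

section SteinInterpolation

open scoped Matrix.Norms.L2Operator
open Matrix

variable {𝕜 m : Type*} [RCLike 𝕜] [Fintype m]

theorem exists_isHermitian_pseudoinverse {P : Matrix m m 𝕜} (hP : P.IsHermitian) :
    ∃ Q : Matrix m m 𝕜, Q.IsHermitian ∧ Commute P Q ∧ P * Q * P = P := by
  classical
  have hcont (f : ℝ → ℝ) : ContinuousOn f (spectrum ℝ P) := P.finite_real_spectrum.continuousOn f
  have hid : cfc (fun x : ℝ => x) P = P := cfc_id' ℝ P hP
  refine ⟨cfc (fun x : ℝ => x⁻¹) P, cfc_predicate _ P, ?_, ?_⟩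
  · simpa only [hid] using cfc_commute_cfc (fun x : ℝ => x) (fun x : ℝ => x⁻¹) P
  · calc P * cfc (fun x : ℝ => x⁻¹) P * P
        = cfc (fun x : ℝ => x) P * cfc (fun x : ℝ => x⁻¹) P * cfc (fun x : ℝ => x) P := by rw [hid]
      _ = cfc (fun x : ℝ => x * x⁻¹ * x) P := by
        rw [cfc_mul _ _ P (hcont _) (hcont _), cfc_mul _ _ P (hcont _) (hcont _)]
      _ = P := by simp only [mul_inv_mul_cancel, hid]

theorem differentiable_trace_mul {V : Type*} [NormedAddCommGroup V] [NormedSpace ℂ V]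
    {f : V → Matrix m m ℂ} (hf : Differentiable ℂ f) (W : Matrix m m ℂ) :
    Differentiable ℂ fun z => (W * f z).trace := by
  classical
  exact (traceLinearMap m ℂ ℂ ∘ₗ
    LinearMap.mulLeft ℂ W).toContinuousLinearMap.differentiable.comp hf

variable [DecidableEq m]

theorem norm_entry_le_l2_opNorm {l : Type*} [Fintype l] (A : Matrix l m 𝕜) (i : l) (j : m) :
    ‖A i j‖ ≤ ‖A‖ := by
  have hcol := A.l2_opNorm_mulVec (EuclideanSpace.single j 1)
  rw [PiLp.norm_single, norm_one, mul_one] at hcol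
  refine le_trans ?_ hcol
  simpa using PiLp.norm_apply_le (p := 2) (WithLp.toLp 2 (A *ᵥ (EuclideanSpace.single j (1 : 𝕜)))) i

theorem l2_opNorm_conj_unitary (U : unitaryGroup m 𝕜) (A : Matrix m m 𝕜) :
    ‖Unitary.conjStarAlgAut 𝕜 _ U A‖ = ‖A‖ := by
  rw [Unitary.conjStarAlgAut_apply, ← Unitary.coe_star, CStarRing.norm_mul_coe_unitary,
    CStarRing.norm_coe_unitary_mul]

theorem norm_trace_mul_conj_diagonal_le (X : Matrix m m 𝕜) (U : unitaryGroup m 𝕜) (v : m → 𝕜) :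
    ‖(X * Unitary.conjStarAlgAut 𝕜 _ U (diagonal v)).trace‖ ≤ ‖X‖ * ∑ i, ‖v i‖ := by
  set Y := Unitary.conjStarAlgAut 𝕜 _ (star U) X
  have htrace : (X * Unitary.conjStarAlgAut 𝕜 _ U (diagonal v)).trace = ∑ i, Y i i * v i := by
    rw [Unitary.conjStarAlgAut_apply, ← Matrix.mul_assoc, trace_mul_comm, ← Matrix.mul_assoc,
      ← Matrix.mul_assoc, ← Unitary.conjStarAlgAut_star_apply (S := 𝕜)]
    simp only [trace, diag_apply, mul_diagonal, Y]
  rw [htrace, Finset.mul_sum]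
  refine norm_sum_le_of_le _ fun i _ => ?_
  rw [norm_mul]
  gcongr
  exact (norm_entry_le_l2_opNorm Y i i).trans_eq (l2_opNorm_conj_unitary _ X)

theorem norm_trace_le (A : Matrix m m 𝕜) : ‖A.trace‖ ≤ ‖A‖ * Fintype.card m := by
  simpa using norm_trace_mul_conj_diagonal_le A 1 1

theorem l2_opNorm_prod_ofFn_le {n : ℕ} (M : Fin n → Matrix m m 𝕜) :
    ‖(List.ofFn M).prod‖ ≤ ∏ k, ‖M k‖ := by
  cases isEmpty_or_nonempty m
  · rw [Subsingleton.elim (List.ofFn M).prod 0, norm_zero]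
    exact Finset.prod_nonneg fun k _ => norm_nonneg _
  · simpa [List.map_ofFn, List.prod_ofFn] using List.norm_prod_le (List.ofFn M)

theorem norm_trace_mul_prod_ofFn_le_of_norm_le_one {n : ℕ} {M : Fin n → Matrix m m 𝕜} {j : Fin n}
    (hM : ∀ k ≠ j, ‖M k‖ ≤ 1) {c : ℝ} (hc : 0 ≤ c)
    (hj : ∀ X : Matrix m m 𝕜, ‖(X * M j).trace‖ ≤ ‖X‖ * c) (X : Matrix m m 𝕜) :
    ‖(X * (List.ofFn M).prod).trace‖ ≤ ‖X‖ * c := by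
  induction n generalizing X with
  | zero => exact j.elim0
  | succ n ih =>
    rw [List.ofFn_succ, List.prod_cons]
    cases j using Fin.cases with
    | zero =>
      set P := (List.ofFn fun k : Fin n => M k.succ).prod
      have hP : ‖P‖ ≤ 1 := (l2_opNorm_prod_ofFn_le _).trans <|
        Finset.prod_le_one (fun _ _ => norm_nonneg _) fun k _ => hM _ k.succ_ne_zero
      rw [← Matrix.mul_assoc, trace_mul_comm, ← Matrix.mul_assoc]
      refine (hj (P * X)).trans (mul_le_mul_of_nonneg_right ?_ hc)
      exact (norm_mul_le P X).trans (mul_le_of_le_one_left (norm_nonneg X) hP)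
    | succ j =>
      rw [← Matrix.mul_assoc]
      refine (ih (fun k hk => hM _ ((Fin.succ_injective n).ne hk)) hj (X * M 0)).trans
        (mul_le_mul_of_nonneg_right ?_ hc)
      exact (norm_mul_le X (M 0)).trans
        (mul_le_of_le_one_right (norm_nonneg X) (hM 0 j.succ_ne_zero.symm))

theorem exists_contraction_mul_eq_abs (A : Matrix m m 𝕜) :
    ∃ W : Matrix m m 𝕜, ‖W‖ ≤ 1 ∧ W * A = CFC.abs A := by
  set P := CFC.abs A
  have hPP : P * P = Aᴴ * A := CFC.abs_mul_abs A
  have hP : P.IsHermitian := (nonneg_iff_posSemidef.1 (CFC.abs_nonneg A)).isHermitian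
  obtain ⟨Q, hQ, hcomm, hPQP⟩ := exists_isHermitian_pseudoinverse hP
  have hproj : IsStarProjection (P * Q) :=
    ⟨by rw [IsIdempotentElem, ← Matrix.mul_assoc, hPQP], (IsSelfAdjoint.commute_iff hP hQ).1 hcomm⟩
  refine ⟨Q * Aᴴ, ?_, ?_⟩
  · have hWW : (Q * Aᴴ) * (Q * Aᴴ)ᴴ = P * Q := by
      calc (Q * Aᴴ) * (Q * Aᴴ)ᴴ = Q * (Aᴴ * A) * Q := by
            simp only [conjTranspose_mul, conjTranspose_conjTranspose, hQ.eq, Matrix.mul_assoc]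
        _ = P * Q * P * Q := by rw [← hPP, ← Matrix.mul_assoc, ← hcomm.eq]
        _ = P * Q := by rw [hPQP]
    have hnorm : ‖Q * Aᴴ‖ * ‖Q * Aᴴ‖ ≤ 1 := by
      rw [← CStarRing.norm_self_mul_star, star_eq_conjTranspose, hWW]
      exact hproj.norm_le
    exact (le_abs_self _).trans (abs_le_one_iff_mul_self_le_one.2 hnorm)
  · rw [Matrix.mul_assoc, ← hPP, ← Matrix.mul_assoc, ← hcomm.eq, hPQP]

/-- An admissible family for Stein interpolation on the strip `0 ≤ re z ≤ 1` between the operator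
norm and the trace norm: an entire matrix function, bounded on the strip, whose values have operator
norm at most `1` on `re z = 0` and trace norm at most `c` on `re z = 1`. The trace norm bound is
expressed by duality, hence the separate condition `0 ≤ c` (which matters if `m` is empty). -/
structure IsSteinFamily (A : ℂ → Matrix m m ℂ) (c : ℝ) : Prop where
  differentiable : Differentiable ℂ A
  bounded : ∃ C, ∀ z : ℂ, z.re ∈ Set.Icc 0 1 → ‖A z‖ ≤ C
  norm_le_one : ∀ z : ℂ, z.re = 0 → ‖A z‖ ≤ 1
  nonneg : 0 ≤ c
  norm_trace_mul_le : ∀ z : ℂ, z.re = 1 → ∀ X : Matrix m m ℂ, ‖(X * A z).trace‖ ≤ ‖X‖ * c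

theorem IsSteinFamily.norm_trace_mul_prod_ofFn_le {n : ℕ} {A : Fin n → ℂ → Matrix m m ℂ}
    {c : Fin n → ℝ} (hA : ∀ k, IsSteinFamily (A k) (c k)) {W : Matrix m m ℂ} (hW : ‖W‖ ≤ 1)
    {z : Fin n → ℂ} (hz : z ∈ tube (stdSimplex ℝ (Fin n))) :
    ‖(W * (List.ofFn fun k => A k (z k)).prod).trace‖ ≤ ∏ k, c k ^ (z k).re := by
  let F : (Fin n → ℂ) → ℂ := fun z => (W * (List.ofFn fun k => A k (z k)).prod).trace
  have hF : Differentiable ℂ F := differentiable_trace_mul (differentiable_prod_ofFn fun k =>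
    (hA k).differentiable.comp (differentiable_apply k)) W
  have hbdd : BddAbove ((norm ∘ F) '' tube (stdSimplex ℝ (Fin n))) := by
    choose C hC using fun k => (hA k).bounded
    refine ⟨1 * (∏ k, C k) * Fintype.card m, ?_⟩
    rintro _ ⟨z, hz, rfl⟩
    have hAz : ∀ k, ‖A k (z k)‖ ≤ C k := fun k => hC k _ ⟨hz.1 k, stdSimplex.le_one ⟨_, hz⟩ k⟩
    refine (norm_trace_le _).trans ?_
    gcongr
    refine (norm_mul_le _ _).trans (mul_le_mul hW ?_ (norm_nonneg _) zero_le_one)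
    exact (l2_opNorm_prod_ofFn_le _).trans (Finset.prod_le_prod (fun _ _ => norm_nonneg _)
      fun k _ => hAz k)
  have hvertex : ∀ j, ∀ z ∈ tube {Pi.single j 1}, ‖F z‖ ≤ c j := by
    intro j z hz
    have hre (k : Fin n) : (z k).re = Pi.single (M := fun _ => ℝ) j 1 k := congrFun hz k
    have hother : ∀ k ≠ j, ‖A k (z k)‖ ≤ 1 := fun k hk => (hA k).norm_le_one _ (by simp [hre, hk])
    refine (norm_trace_mul_prod_ofFn_le_of_norm_le_one hother (hA j).nonneg
      ((hA j).norm_trace_mul_le _ (by simp [hre])) W).trans ?_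
    exact mul_le_of_le_one_left (hA j).nonneg hW
  exact norm_le_prod_rpow_of_mem_tube_stdSimplex hF hbdd (fun k => (hA k).nonneg) hvertex hz

/-- The entire function `z ↦ t ^ z`, with the value `0` for `t = 0` and every `z`. Unlike `t ^ z` it
is continuous at `z = 0` for `t = 0`. -/
noncomputable def entireCpow (t : ℝ) (z : ℂ) : ℂ := if t = 0 then 0 else (t : ℂ) ^ z

theorem differentiable_entireCpow (t : ℝ) : Differentiable ℂ (entireCpow t) := by
  unfold entireCpow
  split_ifs with ht
  · exact differentiable_const 0
  · exact differentiable_id.const_cpow (Or.inl (Complex.ofReal_ne_zero.2 ht))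

theorem norm_entireCpow_le {t : ℝ} (ht : 0 ≤ t) (z : ℂ) : ‖entireCpow t z‖ ≤ t ^ z.re := by
  unfold entireCpow
  split_ifs with h
  · simpa using Real.rpow_nonneg ht _
  · rw [Complex.norm_cpow_eq_rpow_re_of_pos (ht.lt_of_ne' h)]

theorem entireCpow_ofReal {t x : ℝ} (ht : 0 ≤ t) (hx : x ≠ 0) :
    entireCpow t x = ((t ^ x : ℝ) : ℂ) := by
  unfold entireCpow
  split_ifs with h
  · rw [h, Real.zero_rpow hx, Complex.ofReal_zero]
  · rw [Complex.ofReal_cpow ht]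

theorem rpow_le_one_add {t x : ℝ} (ht : 0 ≤ t) (hx : x ∈ Set.Icc 0 1) : t ^ x ≤ 1 + t := by
  calc t ^ x ≤ (1 + t) ^ x := Real.rpow_le_rpow ht (by linarith) hx.1
    _ ≤ (1 + t) ^ (1 : ℝ) := Real.rpow_le_rpow_of_exponent_le (by linarith) hx.2
    _ = 1 + t := Real.rpow_one _

/-- The complex powers of a Hermitian matrix with nonnegative eigenvalues, as an entire family: the
functional calculus of `entireCpow`, so the power at `0` is the projection onto the range. -/
noncomputable def matrixCpow {T : Matrix m m ℂ} (hT : T.IsHermitian) (z : ℂ) : Matrix m m ℂ :=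
  Unitary.conjStarAlgAut ℂ _ hT.eigenvectorUnitary
    (diagonal fun i => entireCpow (hT.eigenvalues i) z)

theorem matrixCpow_ofReal {T : Matrix m m ℂ} (hT : T.PosSemidef) {x : ℝ} (hx : x ≠ 0) :
    matrixCpow hT.isHermitian x = T ^ x := by
  rw [CFC.rpow_eq_cfc_real hT.nonneg, hT.isHermitian.cfc_eq, IsHermitian.cfc, matrixCpow]
  simp only [entireCpow_ofReal (hT.eigenvalues_nonneg _) hx]
  rfl

theorem differentiable_matrixCpow {T : Matrix m m ℂ} (hT : T.IsHermitian) :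
    Differentiable ℂ (matrixCpow hT) := by
  let conj := (Unitary.conjStarAlgAut ℂ _ hT.eigenvectorUnitary).toAlgEquiv.toLinearMap
  exact (conj ∘ₗ diagonalLinearMap m ℂ ℂ).toContinuousLinearMap.differentiable.comp
    (differentiable_pi.2 fun i => differentiable_entireCpow (hT.eigenvalues i))

theorem norm_matrixCpow_le {T : Matrix m m ℂ} (hT : T.PosSemidef) (z : ℂ) {C : ℝ} (hC : 0 ≤ C)
    (h : ∀ i, hT.isHermitian.eigenvalues i ^ z.re ≤ C) : ‖matrixCpow hT.isHermitian z‖ ≤ C := by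
  rw [matrixCpow, l2_opNorm_conj_unitary, l2_opNorm_diagonal]
  exact (pi_norm_le_iff_of_nonneg hC).2 fun i =>
    (norm_entireCpow_le (hT.eigenvalues_nonneg i) z).trans (h i)

theorem isSteinFamily_matrixCpow {T : Matrix m m ℂ} (hT : T.PosSemidef) :
    IsSteinFamily (matrixCpow hT.isHermitian) T.trace.re := by
  have hsum : ∑ i, hT.isHermitian.eigenvalues i = T.trace.re := by
    simp [hT.isHermitian.trace_eq_sum_eigenvalues]
  have htr : 0 ≤ T.trace.re := (Complex.nonneg_iff.1 hT.trace_nonneg).1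
  refine ⟨differentiable_matrixCpow _, ⟨1 + T.trace.re, fun z hz => ?_⟩, fun z hz => ?_, htr,
    fun z hz X => ?_⟩
  · refine norm_matrixCpow_le hT z (by linarith) fun i => ?_
    have := Finset.single_le_sum (fun i _ => hT.eigenvalues_nonneg i) (Finset.mem_univ i)
    have := rpow_le_one_add (hT.eigenvalues_nonneg i) hz
    linarith
  · exact norm_matrixCpow_le hT z zero_le_one fun i => by rw [hz, Real.rpow_zero]
  · refine (norm_trace_mul_conj_diagonal_le X _ _).trans ?_
    rw [← hsum]
    gcongr with i
    simpa [hz] using norm_entireCpow_le (hT.eigenvalues_nonneg i) z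

theorem isSteinFamily_one :
    IsSteinFamily (fun _ => (1 : Matrix m m ℂ)) (Fintype.card m) := by
  have hone : ‖(1 : Matrix m m ℂ)‖ ≤ 1 := IsStarProjection.norm_le 1 (.one _)
  refine ⟨differentiable_const 1, ⟨1, fun _ _ => hone⟩, fun _ _ => hone, Nat.cast_nonneg _,
    fun _ _ X => ?_⟩
  simpa using norm_trace_le X

theorem exists_isSteinFamily_eq_rpow {T : Matrix m m ℂ} (hT : T.PosSemidef) (x : ℝ) :
    ∃ A c, IsSteinFamily A c ∧ A x = T ^ x ∧ c ^ x = T.trace.re ^ x := by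
  rcases eq_or_ne x 0 with rfl | hx
  · exact ⟨_, _, isSteinFamily_one, (CFC.rpow_zero T hT.nonneg).symm,
      by simp only [Real.rpow_zero]⟩
  · exact ⟨_, _, isSteinFamily_matrixCpow hT, matrixCpow_ofReal hT hx, rfl⟩

theorem re_trace_abs_prod_rpow_le {n : ℕ} {T : Fin n → Matrix m m ℂ}
    (hT : ∀ k, (T k).PosSemidef) {x : Fin n → ℝ} (hx : x ∈ stdSimplex ℝ (Fin n)) :
    (CFC.abs (List.ofFn fun k => T k ^ x k).prod).trace.re ≤ ∏ k, (T k).trace.re ^ x k := by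
  obtain ⟨W, hW, habs⟩ := exists_contraction_mul_eq_abs (List.ofFn fun k => T k ^ x k).prod
  choose A c hA hAx hcx using fun k => exists_isSteinFamily_eq_rpow (hT k) (x k)
  rw [← habs]
  simp only [← hAx, ← hcx]
  exact (Complex.re_le_norm _).trans
    (IsSteinFamily.norm_trace_mul_prod_ofFn_le hA hW (z := fun k => x k) hx)

end SteinInterpolation

theorem theorem5p7_general {m : Type*} [Fintype m] [DecidableEq m] {n : ℕ}
    (T : Fin n → Matrix m m ℂ) (hT : ∀ k, (T k).PosSemidef) (ϑ : Fin n → ℝ)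
    (hsum : ∑ k, ϑ k = 1) {r : ℝ} (hr : 0 ≤ r) (hrϑ : ∀ k, r ≤ ϑ k) :
    (CFC.abs (List.ofFn fun k => T k ^ ϑ k).prod).trace.re +
        r * (∑ k, (T k).trace.re - (n : ℝ) * (∏ k, (T k).trace.re) ^ (1 / (n : ℝ)))
      ≤ ∑ k, (ϑ k • T k).trace.re := by
  have holder := re_trace_abs_prod_rpow_le hT ⟨fun k => hr.trans (hrϑ k), hsum⟩
  have amgm := geom_mean_weighted_add_gap_le_arith_mean_weighted Finset.univ ϑ
    (fun k => (T k).trace.re) hr (fun k _ => hrϑ k) hsum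
    fun k _ => (Complex.nonneg_iff.1 (hT k).trace_nonneg).1
  simp only [Matrix.trace_smul, Complex.real_smul, Complex.re_ofReal_mul]
  rw [Finset.card_univ, Fintype.card_fin] at amgm
  linarith

theorem theorem5p7 {n d : ℕ} (T : Fin n → Matrix (Fin d) (Fin d) ℂ)
    (hT : ∀ k, (T k).PosSemidef) (ϑ : Fin n → ℝ)
    (hϑ : ∀ k, 0 ≤ ϑ k ∧ ϑ k ≤ 1) (hsum : ∑ k, ϑ k = 1)
    (r : ℝ) (hr : IsLeast (Set.range ϑ) r) :
    (CFC.abs (List.ofFn fun k => T k ^ ϑ k).prod).trace.re +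
        r * (∑ k, (T k).trace.re - (n : ℝ) * (∏ k, (T k).trace.re) ^ (1 / (n : ℝ)))
      ≤ ∑ k, (ϑ k • T k).trace.re := by
  obtain ⟨⟨k, rfl⟩, hmin⟩ := hr
  exact theorem5p7_general T hT ϑ hsum (hϑ k).1 fun j => hmin ⟨j, rfl⟩
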